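/- Let $\mathbb{T}=(\mathbb{R}\cup\{-\infty\},\oplus,\otimes)$ be the tropical semiring, where $\oplus$ is the maximum and $\otimes$ is addition, and let $M_n(\mathbb{F}\mathbb{T})$ be the semigroup, under tropical matrix multiplication, of all $n\times n$ matrices over $\mathbb{F}\mathbb{T}=\mathbb{T}\setminus\{-\infty\}$ (that is, with all entries finite). A maximal subgroup of a semigroup $S$ is a subsemigroup of $S$ that is a group under the multiplication of $S$ and that is maximal with respect to inclusion among all such subsemigroups (its identity element need not be an identity of $S$). For every finite group $G$ and every integer $n\ge |G|$, the semigroup $M_n(\mathbb{F}\mathbb{T})$ has a maximal subgroup isomorphic to $G\times\mathbb{R}$, where $\mathbb{R}$ denotes the additive group of real numbers. -/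

import Mathlib

/-- The tropical semiring on `ℝ ∪ {-∞}`. Mathlib's `Tropical R` is min-plus over `R`; applied to the
order dual it is max-plus, so here `⊕` (written `+`) is the maximum, `⊗` (written `*`) is the usual
addition, `0` is `-∞` and `1` is the real number `0`; see the lemmas below. -/
abbrev MaxPlus : Type := Tropical (WithTop ℝᵒᵈ)

namespace MaxPlus

/-- The finite element of the tropical semiring given by a real number. -/
def ofReal (x : ℝ) : MaxPlus := Tropical.trop ((OrderDual.toDual x : ℝᵒᵈ) : WithTop ℝᵒᵈ)

theorem ofReal_injective : Function.Injective ofReal := fun _ _ h =>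
  OrderDual.toDual.injective (WithTop.coe_injective (Tropical.trop_injective h))

theorem ofReal_ne_zero (x : ℝ) : ofReal x ≠ 0 := fun h =>
  WithTop.coe_ne_top (Tropical.trop_injective h)

theorem ne_zero_iff (a : MaxPlus) : a ≠ 0 ↔ ∃ x : ℝ, a = ofReal x := by
  constructor
  · intro h
    have h' : Tropical.untrop a ≠ ⊤ := fun h' => h (Tropical.untrop_injective h')
    obtain ⟨y, hy⟩ := WithTop.ne_top_iff_exists.mp h'
    exact ⟨OrderDual.ofDual y, Tropical.untrop_injective hy.symm⟩
  · rintro ⟨x, rfl⟩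
    exact ofReal_ne_zero x

theorem ofReal_add_ofReal (x y : ℝ) : ofReal x + ofReal y = ofReal (max x y) := by
  apply Tropical.untrop_injective
  change min ((OrderDual.toDual x : ℝᵒᵈ) : WithTop ℝᵒᵈ) ((OrderDual.toDual y : ℝᵒᵈ) : WithTop ℝᵒᵈ)
    = _
  rw [← WithTop.coe_min]
  rfl

theorem ofReal_mul_ofReal (x y : ℝ) : ofReal x * ofReal y = ofReal (x + y) := rfl

theorem one_eq_ofReal : (1 : MaxPlus) = ofReal 0 := rfl

end MaxPlus

/-- The semigroup `M_n(𝔽𝕋)` of `n × n` matrices over the finitary tropical semiring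
`𝔽𝕋 = 𝕋 \ {-∞}`, as a subsemigroup of the multiplicative monoid `M_n(𝕋)`. -/
def finitaryMatrices (n : ℕ) : Subsemigroup (Matrix (Fin n) (Fin n) MaxPlus) where
  carrier := {A | ∀ i j, A i j ≠ 0}
  mul_mem' := by
    intro A B hA hB i j h
    rw [Matrix.mul_apply, ← Finset.add_sum_erase _ _ (Finset.mem_univ i)] at h
    rcases Tropical.mul_eq_zero_iff.mp (Tropical.add_eq_zero_iff.mp h).1 with h | h
    · exact hA i i h
    · exact hB i j h

/-- The subsemigroup `T` of `S` is a group under the multiplication of `S`. Its identity element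
is an idempotent of `S`, and need not be an identity element of `S`. -/
def IsSubgroupOf {S : Type*} [Semigroup S] (T : Subsemigroup S) : Prop :=
  ∃ e ∈ T, ∀ x ∈ T, e * x = x ∧ x * e = x ∧ ∃ y ∈ T, x * y = e ∧ y * x = e

/-- A maximal subgroup of a semigroup: a subsemigroup that is a group, and that is maximal with
respect to inclusion among such subsemigroups. -/
def IsMaximalSubgroup {S : Type*} [Semigroup S] (T : Subsemigroup S) : Prop :=
  Maximal IsSubgroupOf T

namespace MaxPlus

/-! Let `d` be an injective gauge on `G`. By the triangle inequality `-d (i⁻¹ * j)` is a tropical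
idempotent `E`, and the matrices `t - d (i⁻¹ * x * j)` form a copy of `G × ℝ` with identity `E`. If
`n > |G|`, rows and columns are repeated along a surjection `p`. For maximality, a unit of the local
monoid at `E` determines a permutation `s` of `G` under which `d` is carried to a diagonal rescaling
of itself (`exists_eq_translate`). The rescaling is trivial (`rescaling_const`), and then
injectivity of `d` makes `s` a left multiplication. -/

theorem sum_ofReal {ι : Type*} {s : Finset ι} (hs : s.Nonempty) (f : ι → ℝ) :
    ∑ i ∈ s, ofReal (f i) = ofReal (s.sup' hs f) := by
  induction hs using Finset.Nonempty.cons_induction with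
  | singleton a => simp
  | cons a s ha hs ih =>
    rw [Finset.sum_cons, ih, ofReal_add_ofReal, Finset.sup'_cons hs]

theorem sum_ofReal_eq_iff {ι : Type*} [Fintype ι] [Nonempty ι] (f : ι → ℝ) (c : ℝ) :
    ∑ i, ofReal (f i) = ofReal c ↔ (∀ i, f i ≤ c) ∧ ∃ i, f i = c := by
  rw [sum_ofReal Finset.univ_nonempty, ofReal_injective.eq_iff]
  constructor
  · rintro rfl
    refine ⟨fun i => Finset.le_sup' f (Finset.mem_univ i), ?_⟩
    obtain ⟨i, -, hi⟩ := Finset.exists_mem_eq_sup' Finset.univ_nonempty f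
    exact ⟨i, hi.symm⟩
  · rintro ⟨h, i, rfl⟩
    exact le_antisymm (Finset.sup'_le _ _ fun j _ => h j) (Finset.le_sup' f (Finset.mem_univ i))

end MaxPlus

open MaxPlus

/-- The finitary matrix with given real entries. -/
def finitaryMatrices.ofRealMatrix {n : ℕ} (a : Fin n → Fin n → ℝ) : finitaryMatrices n :=
  ⟨fun i j => ofReal (a i j), fun i j => ofReal_ne_zero (a i j)⟩

namespace finitaryMatrices

theorem exists_eq_ofRealMatrix {n : ℕ} (A : finitaryMatrices n) : ∃ a, A = ofRealMatrix a := by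
  choose a ha using fun i j => (ne_zero_iff _).mp (A.2 i j)
  exact ⟨a, Subtype.ext (funext fun i => funext fun j => ha i j)⟩

theorem ofRealMatrix_injective {n : ℕ} :
    Function.Injective (ofRealMatrix : (Fin n → Fin n → ℝ) → finitaryMatrices n) :=
  fun _ _ h => funext fun i => funext fun j =>
    ofReal_injective (congrFun (congrFun (congrArg Subtype.val h) i) j)

theorem ofRealMatrix_mul_eq_iff {n : ℕ} (a b c : Fin n → Fin n → ℝ) :
    ofRealMatrix a * ofRealMatrix b = ofRealMatrix c ↔
      ∀ i j, (∀ k, a i k + b k j ≤ c i j) ∧ ∃ k, a i k + b k j = c i j := by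
  rw [Subtype.ext_iff, ← Matrix.ext_iff]
  refine forall_congr' fun i => forall_congr' fun j => ?_
  have : Nonempty (Fin n) := ⟨i⟩
  exact sum_ofReal_eq_iff (fun k => a i k + b k j) (c i j)

end finitaryMatrices

open finitaryMatrices

/-- A left-invariant quasi-metric on a group, given as a function of `i⁻¹ * j`, that takes
different values at different elements. -/
structure InjectiveGauge (G : Type*) [Group G] where
  /-- The value of the gauge at a group element. -/
  toFun : G → ℝ
  map_one : toFun 1 = 0
  pos : ∀ g, g ≠ 1 → 0 < toFun g
  map_mul_le : ∀ g h, toFun (g * h) ≤ toFun g + toFun h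
  injective : Function.Injective toFun

namespace InjectiveGauge

/-- Distinct values in `(1, 2]` away from the identity suffice: a sum of two of them exceeds 2, so
subadditivity is automatic. -/
theorem nonempty_of_finite (G : Type*) [Group G] [Finite G] : Nonempty (InjectiveGauge G) := by
  classical
  obtain ⟨N, ⟨e⟩⟩ := Finite.exists_equiv_fin G
  let v : G → ℝ := fun g => 1 + 1 / ((e g : ℕ) + 1)
  have hv1 : ∀ g, 1 < v g := fun g => lt_add_of_pos_right _ (by positivity)
  have hv2 : ∀ g, v g ≤ 2 := fun g => by
    have : (1 : ℝ) / ((e g : ℕ) + 1) ≤ 1 :=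
      (div_le_one (by positivity)).mpr (le_add_of_nonneg_left (by positivity))
    exact (add_le_add_right this 1).trans_eq one_add_one_eq_two
  have hv : Function.Injective v := fun g h hgh => by
    have : ((e g : ℕ) : ℝ) = (e h : ℕ) := by simpa [v] using hgh
    exact e.injective (Fin.ext (by exact_mod_cast this))
  clear_value v
  refine ⟨⟨fun g => if g = 1 then 0 else v g, if_pos rfl, fun g hg => ?_, fun g h => ?_,
    fun g h hgh => ?_⟩⟩
  · have := hv1 g
    simp only [if_neg hg]
    linarith
  · have := hv1 g
    have := hv1 h
    have := hv2 (g * h)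
    by_cases hg : g = 1
    · simp [hg]
    by_cases hh : h = 1
    · simp [hh]
    simp only [if_neg hg, if_neg hh]
    split_ifs <;> linarith
  · have := hv1 g
    have := hv1 h
    by_cases hg : g = 1 <;> by_cases hh : h = 1
    · rw [hg, hh]
    · simp only [if_pos hg, if_neg hh] at hgh
      linarith
    · simp only [if_neg hg, if_pos hh] at hgh
      linarith
    · simp only [if_neg hg, if_neg hh] at hgh
      exact hv hgh

variable {G : Type*} [Group G] (d : InjectiveGauge G)

theorem nonneg (g : G) : 0 ≤ d.toFun g := by
  by_cases hg : g = 1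
  · rw [hg, d.map_one]
  · exact (d.pos g hg).le

theorem eq_one_of_add_inv_eq_zero {g : G} (h : d.toFun g + d.toFun g⁻¹ = 0) : g = 1 := by
  by_contra hg
  linarith [d.pos g hg, d.nonneg g⁻¹]

/-- A diagonal rescaling of a finite left-invariant quasi-metric that is a rearrangement of it has
constant scaling factors. -/
theorem rescaling_const [Finite G] (s : Equiv.Perm G) (l : G → ℝ)
    (h : ∀ i j, d.toFun ((s i)⁻¹ * s j) = d.toFun (i⁻¹ * j) + l i - l j) (i j : G) :
    l i = l j := by
  cases nonempty_fintype G
  -- Compare sums of squares: permuting by `s` preserves them, and the cross terms cancel because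
  -- all rows and columns of `d (i⁻¹ * j)` have the same sum. Only `∑ (l i - l j) ^ 2` is left, so
  -- it vanishes.
  have hsq : ∑ i, ∑ j, d.toFun ((s i)⁻¹ * s j) ^ 2 = ∑ i, ∑ j, d.toFun (i⁻¹ * j) ^ 2 := by
    rw [Equiv.sum_comp s fun x => ∑ j, d.toFun (x⁻¹ * s j) ^ 2]
    exact Finset.sum_congr rfl fun x _ => Equiv.sum_comp s fun y => d.toFun (x⁻¹ * y) ^ 2
  have hrow : ∑ i, ∑ j, d.toFun (i⁻¹ * j) * l i = (∑ g, d.toFun g) * ∑ i, l i := by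
    rw [Finset.mul_sum]
    refine Finset.sum_congr rfl fun x _ => ?_
    rw [← Finset.sum_mul]
    congr 1
    exact Equiv.sum_comp (Equiv.mulLeft x⁻¹) d.toFun
  have hcol : ∑ i, ∑ j, d.toFun (i⁻¹ * j) * l j = (∑ g, d.toFun g) * ∑ i, l i := by
    rw [Finset.sum_comm, Finset.mul_sum]
    refine Finset.sum_congr rfl fun x _ => ?_
    rw [← Finset.sum_mul]
    congr 1
    exact Equiv.sum_comp ((Equiv.inv G).trans (Equiv.mulRight x)) d.toFun
  have hexp : ∑ i, ∑ j, d.toFun ((s i)⁻¹ * s j) ^ 2 = ∑ i, ∑ j, d.toFun (i⁻¹ * j) ^ 2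
      + 2 * (∑ i, ∑ j, d.toFun (i⁻¹ * j) * l i) - 2 * (∑ i, ∑ j, d.toFun (i⁻¹ * j) * l j)
      + ∑ i, ∑ j, (l i - l j) ^ 2 := by
    simp only [Finset.mul_sum, ← Finset.sum_add_distrib, ← Finset.sum_sub_distrib]
    refine Finset.sum_congr rfl fun x _ => Finset.sum_congr rfl fun y _ => ?_
    rw [h]
    ring
  have hzero : ∑ i, ∑ j, (l i - l j) ^ 2 = 0 := by linarith
  rw [Finset.sum_eq_zero_iff_of_nonneg fun x _ => Finset.sum_nonneg fun y _ => sq_nonneg _] at hzero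
  have := (Finset.sum_eq_zero_iff_of_nonneg fun y _ => sq_nonneg _).mp
    (hzero i (Finset.mem_univ i)) j (Finset.mem_univ j)
  exact sub_eq_zero.mp (pow_eq_zero_iff two_ne_zero |>.mp this)

/-- Matrices indexed by `G` that are units of the local monoid at the idempotent
`-d (i⁻¹ * j)` are translates of that idempotent. -/
theorem exists_eq_translate [Finite G] (a b : G → G → ℝ)
    (hone : ∀ i, ∃ k, a i k + b k i = 0)
    (hba : ∀ k i j, b k i + a i j ≤ -d.toFun (k⁻¹ * j))
    (hab : ∀ i j k, a i j + b j k ≤ -d.toFun (i⁻¹ * k))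
    (hright : ∀ i k j, a i k - d.toFun (k⁻¹ * j) ≤ a i j)
    (hleft : ∀ i j k, -d.toFun (i⁻¹ * k) + a k j ≤ a i j) :
    ∃ (x : G) (t : ℝ), ∀ i j, a i j = t - d.toFun (i⁻¹ * x * j) := by
  choose s hs using hone
  -- Where `a i k + b k i = 0` is attained, the bounds are tight: row `i` of `a` is a shifted row `s
  -- i` of `E`, and column `s i` of `a` a shifted column `i`.
  have hrow : ∀ i j, a i j = a i (s i) - d.toFun ((s i)⁻¹ * j) := fun i j => by
    linarith [hba (s i) i j, hright i (s i) j, hs i]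
  have hcol : ∀ i j, a j (s i) = a i (s i) - d.toFun (j⁻¹ * i) := fun i j => by
    linarith [hab j (s i) i, hleft j (s i) i, hs i]
  have hscale : ∀ i j, d.toFun ((s i)⁻¹ * s j) = d.toFun (i⁻¹ * j) + a i (s i) - a j (s j) :=
    fun i j => by linarith [hrow i (s j), hcol j i]
  have hinj : Function.Injective s := fun i j hij => by
    have h1 := hscale i j
    have h2 := hscale j i
    rw [hij, inv_mul_cancel, d.map_one] at h1 h2
    refine inv_mul_eq_one.mp (d.eq_one_of_add_inv_eq_zero ?_)
    rw [mul_inv_rev, inv_inv]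
    linarith
  have hconst := d.rescaling_const (Equiv.ofBijective s (Finite.injective_iff_bijective.mp hinj))
    (fun i => a i (s i)) hscale
  have htrans : ∀ i, s i = s 1 * i := fun i => by
    have h := d.injective ((hscale 1 i).trans (by linarith [hconst 1 i]))
    simpa [inv_mul_eq_iff_eq_mul] using h
  refine ⟨(s 1)⁻¹, a 1 (s 1), fun i j => ?_⟩
  rw [hrow i j, hconst i 1, htrans i, mul_inv_rev]

variable {n : ℕ} {p : Fin n → G} (hp : Function.Surjective p)

/-- The embedding of `G × ℝ` into the finitary matrices: `(x, t)` is sent to the translate by `x`,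
scaled by `t`, of the idempotent given by the gauge, with rows and columns repeated along `p`. -/
def translateHom : G × Multiplicative ℝ →ₙ* finitaryMatrices n where
  toFun x := ofRealMatrix fun i j => x.2.toAdd - d.toFun ((p i)⁻¹ * x.1 * p j)
  map_mul' x y := by
    symm
    rw [ofRealMatrix_mul_eq_iff]
    intro i j
    simp only [Prod.fst_mul, Prod.snd_mul, toAdd_mul]
    refine ⟨fun k => ?_, ?_⟩
    · have h := d.map_mul_le ((p i)⁻¹ * x.1 * p k) ((p k)⁻¹ * y.1 * p j)
      have e : (p i)⁻¹ * x.1 * p k * ((p k)⁻¹ * y.1 * p j) = (p i)⁻¹ * (x.1 * y.1) * p j := by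
        group
      rw [e] at h
      linarith
    -- The maximum is attained where the first gauge term is `d 1 = 0`.
    · obtain ⟨k, hk⟩ := hp (x.1⁻¹ * p i)
      refine ⟨k, ?_⟩
      have e1 : (p i)⁻¹ * x.1 * (x.1⁻¹ * p i) = 1 := by group
      have e2 : (x.1⁻¹ * p i)⁻¹ * y.1 * p j = (p i)⁻¹ * (x.1 * y.1) * p j := by group
      rw [hk, e1, e2, d.map_one]
      ring

theorem translateHom_apply (x : G × Multiplicative ℝ) : d.translateHom hp x =
    ofRealMatrix fun i j => x.2.toAdd - d.toFun ((p i)⁻¹ * x.1 * p j) := rfl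

theorem translateHom_injective : Function.Injective (d.translateHom hp) := by
  intro x y hxy
  have h : ∀ g h : G, x.2.toAdd - d.toFun (g⁻¹ * x.1 * h) = y.2.toAdd - d.toFun (g⁻¹ * y.1 * h) := by
    intro g h
    obtain ⟨i, rfl⟩ := hp g
    obtain ⟨j, rfl⟩ := hp h
    exact congrFun (congrFun (ofRealMatrix_injective hxy) i) j
  have h1 := h x.1 1
  have h2 := h y.1 1
  simp only [inv_mul_cancel, mul_one, d.map_one] at h1 h2
  have h3 : (x.1⁻¹ * y.1) = 1 := d.eq_one_of_add_inv_eq_zero (by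
    rw [mul_inv_rev, inv_inv]
    linarith)
  have h4 : x.1 = y.1 := inv_mul_eq_one.mp h3
  refine Prod.ext h4 (Multiplicative.toAdd.injective ?_)
  rw [h3, d.map_one] at h1
  linarith

theorem mem_srange_translateHom [Finite G] {A B : finitaryMatrices n}
    (hEA : d.translateHom hp 1 * A = A) (hAE : A * d.translateHom hp 1 = A)
    (hEB : d.translateHom hp 1 * B = B) (hBE : B * d.translateHom hp 1 = B)
    (hAB : A * B = d.translateHom hp 1) (hBA : B * A = d.translateHom hp 1) :
    A ∈ (d.translateHom hp).srange := by
  -- Rows of `E` with equal `p`-value coincide, hence so do those of `C = E * C`; likewise for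
  -- columns.
  have factor : ∀ C : finitaryMatrices n, d.translateHom hp 1 * C = C →
      C * d.translateHom hp 1 = C →
      ∃ c : G → G → ℝ, C = ofRealMatrix fun i j => c (p i) (p j) := by
    intro C h1 h2
    obtain ⟨c, rfl⟩ := exists_eq_ofRealMatrix C
    rw [translateHom_apply, ofRealMatrix_mul_eq_iff] at h1 h2
    have hrow : ∀ i i' j, p i = p i' → c i j ≤ c i' j := fun i i' j hi => by
      obtain ⟨k, hk⟩ := (h1 i j).2
      have := (h1 i' j).1 k
      rw [← hi] at this
      linarith
    have hcol : ∀ i j j', p j = p j' → c i j ≤ c i j' := fun i j j' hj => by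
      obtain ⟨k, hk⟩ := (h2 i j).2
      have := (h2 i j').1 k
      rw [← hj] at this
      linarith
    obtain ⟨r, hr⟩ := hp.hasRightInverse
    refine ⟨fun g h => c (r g) (r h), congrArg _ (funext fun i => funext fun j => ?_)⟩
    exact le_antisymm ((hrow _ _ _ (hr _).symm).trans (hcol _ _ _ (hr _).symm))
      ((hrow _ _ _ (hr _)).trans (hcol _ _ _ (hr _)))
  obtain ⟨a, rfl⟩ := factor A hEA hAE
  obtain ⟨b, rfl⟩ := factor B hEB hBE
  rw [translateHom_apply, ofRealMatrix_mul_eq_iff] at hEA hAE hAB hBA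
  simp only [Prod.snd_one, toAdd_one, Prod.fst_one, mul_one, zero_sub] at hEA hAE hAB hBA
  obtain ⟨x, t, h⟩ := d.exists_eq_translate a b
    (fun g => by
      obtain ⟨i, rfl⟩ := hp g
      obtain ⟨k, hk⟩ := (hAB i i).2
      rw [inv_mul_cancel, d.map_one, neg_zero] at hk
      exact ⟨p k, hk⟩)
    (fun g₁ g₂ g₃ => by
      obtain ⟨i, rfl⟩ := hp g₁
      obtain ⟨j, rfl⟩ := hp g₂
      obtain ⟨k, rfl⟩ := hp g₃
      exact (hBA i k).1 j)
    (fun g₁ g₂ g₃ => by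
      obtain ⟨i, rfl⟩ := hp g₁
      obtain ⟨j, rfl⟩ := hp g₂
      obtain ⟨k, rfl⟩ := hp g₃
      exact (hAB i k).1 j)
    (fun g₁ g₂ g₃ => by
      obtain ⟨i, rfl⟩ := hp g₁
      obtain ⟨j, rfl⟩ := hp g₂
      obtain ⟨k, rfl⟩ := hp g₃
      exact (hAE i k).1 j)
    (fun g₁ g₂ g₃ => by
      obtain ⟨i, rfl⟩ := hp g₁
      obtain ⟨j, rfl⟩ := hp g₂
      obtain ⟨k, rfl⟩ := hp g₃
      exact (hEA i j).1 k)
  exact ⟨(x, Multiplicative.ofAdd t),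
    congrArg ofRealMatrix (funext fun i => funext fun j => (h (p i) (p j)).symm)⟩

end InjectiveGauge

/-- The image of a group under a homomorphism to a semigroup is a group. -/
theorem isSubgroupOf_srange {S H : Type*} [Semigroup S] [Group H] (f : H →ₙ* S) :
    IsSubgroupOf f.srange := by
  refine ⟨f 1, ⟨1, rfl⟩, ?_⟩
  rintro _ ⟨x, rfl⟩
  exact ⟨by rw [← map_mul, one_mul], by rw [← map_mul, mul_one], f x⁻¹, ⟨x⁻¹, rfl⟩,
    by rw [← map_mul, mul_inv_cancel], by rw [← map_mul, inv_mul_cancel]⟩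

theorem InjectiveGauge.isMaximalSubgroup_srange {G : Type*} [Group G] [Finite G]
    (d : InjectiveGauge G) {n : ℕ} {p : Fin n → G} (hp : Function.Surjective p) :
    IsMaximalSubgroup (d.translateHom hp).srange := by
  refine ⟨isSubgroupOf_srange _, ?_⟩
  rintro T ⟨e, he, hT⟩ hle A hA
  have hmem : d.translateHom hp 1 ∈ T := hle ⟨1, rfl⟩
  have hidem : d.translateHom hp 1 * d.translateHom hp 1 = d.translateHom hp 1 := by
    rw [← map_mul, mul_one]
  obtain ⟨-, -, y, -, hy, -⟩ := hT _ hmem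
  -- An idempotent in a group is its identity.
  have hE : d.translateHom hp 1 = e := by
    have := hidem
    apply_fun (· * y) at this
    rwa [mul_assoc, hy, (hT _ hmem).2.1] at this
  obtain ⟨hEA, hAE, B, hB, hAB, hBA⟩ := hT A hA
  obtain ⟨hEB, hBE, -⟩ := hT B hB
  rw [← hE] at hEA hAE hAB hBA hEB hBE
  exact d.mem_srange_translateHom hp hEA hAE hEB hBE hAB hBA

theorem mainTheorem10 (G : Type*) [Group G] [Finite G] (n : ℕ) (hn : Nat.card G ≤ n) :
    ∃ H : Subsemigroup (finitaryMatrices n),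
      IsMaximalSubgroup H ∧ Nonempty (H ≃* G × Multiplicative ℝ) := by
  obtain ⟨d⟩ := InjectiveGauge.nonempty_of_finite G
  let ι : G → Fin n := fun g => Fin.castLE hn (Finite.equivFin G g)
  have hι : Function.Injective ι :=
    (Fin.castLE_injective hn).comp (Finite.equivFin G).injective
  have hp : Function.Surjective (Function.invFun ι) := Function.invFun_surjective hι
  refine ⟨(d.translateHom hp).srange, d.isMaximalSubgroup_srange hp, ⟨MulEquiv.symm ?_⟩⟩
  exact MulEquiv.ofBijective (d.translateHom hp).srangeRestrict
    ⟨fun x y hxy => d.translateHom_injective hp (congrArg Subtype.val hxy),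
      (d.translateHom hp).srangeRestrict_surjective⟩
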